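/- For positive integers $q,n$ let $$c_q(n)=\sum_{\substack{1\le k\le q\\ (k,q)=1}} e^{2\pi i k n/q}$$ be the Ramanujan sum, let $\mu$ be the Möbius function, $\phi$ Euler's totient function and $\Lambda$ the von Mangoldt function, and put $\Lambda_1(n)=\frac{\phi(n)}{n}\Lambda(n)$. Then for every integer $n\ge 2$ the series $$\sum_{q=1}^{\infty}\frac{\mu(q)}{\phi(q)}\,c_q(n)\,z^q$$ converges absolutely for every real $z$ with $0<z<1$, and $$\lim_{z\to 1^-}\ \sum_{q=1}^{\infty}\frac{\mu(q)}{\phi(q)}\,c_q(n)\,z^q=\Lambda_1(n).$$ -/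

import Mathlib

/-- The Ramanujan sum `c_q(n)`: the sum of `exp (2 π i (k / q) n)` over the integers
`1 ≤ k ≤ q` coprime to `q`. -/
noncomputable def ramanujanSum (q n : ℕ) : ℂ :=
  ∑ k ∈ (Finset.Icc 1 q).filter (fun k => Nat.Coprime k q),
    Complex.exp (2 * (Real.pi : ℂ) * Complex.I * ((k : ℂ) / (q : ℂ)) * (n : ℂ))

/-- The modified von Mangoldt function `Λ₁(n) = φ(n) Λ(n) / n`. -/
noncomputable def modifiedVonMangoldt (n : ℕ) : ℝ :=
  (Nat.totient n : ℝ) / (n : ℝ) * ArithmeticFunction.vonMangoldt n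

/-- The `q`-th term `μ(q) / φ(q) * c_q(n) * z ^ q` of the Ramanujan expansion power series
related to `Λ₁`. -/
noncomputable def lambdaOneTerm (z : ℝ) (n q : ℕ) : ℂ :=
  ((ArithmeticFunction.moebius q : ℤ) : ℂ) / (Nat.totient q : ℂ) * ramanujanSum q n * (z : ℂ) ^ q

/-- The Ramanujan expansion power series `Λ₁(z, n)`, summed over all integers `q ≥ 1`. -/
noncomputable def lambdaOnePowerSeries (z : ℝ) (n : ℕ) : ℂ :=
  ∑' q : ℕ+, lambdaOneTerm z n (q : ℕ)

/-!
For fixed `n` the coefficient `a(q) = μ(q) c_q(n) / φ(q)` is a multiplicative function of `q`.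
By Kluyver's formula `c_q(n) = ∑_{d ∣ (q, n)} μ(q / d) d`, comparison at prime powers shows that
`a` is the Dirichlet convolution of `μ` restricted to the divisors of `n` with
`g(m) = μ(m)² / φ(m)` restricted to the `m` coprime to `n` (`ramanujanCoeff_eq_mul`). Hence, with
`G(z) = ∑ g(m) z ^ m`, the series in question is the finite sum `∑_{d ∣ n} μ(d) G(z ^ d)`.

The function `G` satisfies `G(z) = - κ log (1 - z) + C + o(1)` as `z → 1⁻`, where `κ = φ(n) / n`.
Indeed, let `b` be given by `m g(m) = ∑_{d ∣ m} b(d)`. Expanding gives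
`G(z) = - ∑_d b(d) / d * log (1 - z ^ d)`, and
`0 ≤ log ((1 - z ^ d) / (1 - z)) ≤ log d`, so dominated convergence applies once
`∑ |b(d)| log d / d` is finite (`exists_tendsto_tsum_mul_pow_add_log`). The kernel `b` is supported
on integers without prime factors of multiplicity three or more, `b(p)` is of size `1 / p` when
`p ∤ n`, and `b(p ^ 2)` is bounded, so the convergence follows from a comparison with an Euler
product (`summable_abs_coprimeKernel_mul_rpow`). The value `κ = ∑ b(d) / d` is read off from the
Euler product, whose factor is `1 - 1 / p` for `p ∣ n` and `1` otherwise
(`tsum_coprimeKernel_div`).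

Since `∑_{d ∣ n} μ(d) = 0` for `n ≥ 2`, the constant `C` and the divergent logarithm drop out of
`∑_{d ∣ n} μ(d) G(z ^ d)`, and as `log (1 - z ^ d) - log (1 - z) → log d` the limit is
`- κ ∑_{d ∣ n} μ(d) log d = κ Λ(n)`. Only absolutely convergent series are involved; in particular
no form of the prime number theorem is needed.
-/

/-! ### Dirichlet convolutions at prime powers -/

open ArithmeticFunction in
/-- If `u` vanishes at `p ^ i` for `i ≥ 2`, only two terms of the Dirichlet convolution `u * f`
survive at a positive power of the prime `p`. -/
lemma mul_apply_prime_pow_succ {u f : ArithmeticFunction ℝ} {p : ℕ} (hp : p.Prime)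
    (hu : ∀ i, 2 ≤ i → u (p ^ i) = 0) (k : ℕ) :
    (u * f) (p ^ (k + 1)) = u 1 * f (p ^ (k + 1)) + u p * f (p ^ k) := by
  rw [mul_apply, Nat.sum_divisorsAntidiagonal (f := fun a b => u a * f b),
    Nat.sum_divisors_prime_pow hp, Finset.sum_range_succ', Finset.sum_range_succ',
    Finset.sum_eq_zero]
  · have h : p ^ (k + 1) / p = p ^ k := by rw [pow_succ, Nat.mul_div_cancel _ hp.pos]
    simp [h]
    ring
  · intro i _
    rw [hu _ (by omega), zero_mul]

lemma moebius_prime_pow_eq_zero {p : ℕ} (hp : p.Prime) (i : ℕ) (hi : 2 ≤ i) :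
    ((ArithmeticFunction.moebius : ArithmeticFunction ℝ)) (p ^ i) = 0 := by
  have h1 : i ≠ 1 := by omega
  have h0 : i ≠ 0 := by omega
  simp [ArithmeticFunction.moebius_apply_prime_pow hp h0, h1]

lemma mul_dvd_iff_of_coprime {a b n : ℕ} (hab : a.Coprime b) : a * b ∣ n ↔ a ∣ n ∧ b ∣ n :=
  ⟨fun h => ⟨dvd_of_mul_right_dvd h, dvd_of_mul_left_dvd h⟩,
    fun h => hab.mul_dvd_of_dvd_of_dvd h.1 h.2⟩

/-! ### Ramanujan sums -/

/-- Sum of the values at `n` of the additive characters of `ℤ / q`. -/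
lemma sum_exp_Icc_eq_ite (q n : ℕ) (hq : 0 < q) :
    ∑ k ∈ Finset.Icc 1 q,
      Complex.exp (2 * (Real.pi : ℂ) * Complex.I * ((k : ℂ) / (q : ℂ)) * (n : ℂ)) =
    if q ∣ n then (q : ℂ) else 0 := by
  have hq' : (q : ℂ) ≠ 0 := by exact_mod_cast hq.ne'
  set ζ : ℂ := Complex.exp (2 * (Real.pi : ℂ) * Complex.I * ((n : ℂ) / (q : ℂ))) with hζ
  have hpow : ∀ k : ℕ,
      Complex.exp (2 * (Real.pi : ℂ) * Complex.I * ((k : ℂ) / (q : ℂ)) * (n : ℂ)) = ζ ^ k := by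
    intro k
    rw [hζ, ← Complex.exp_nat_mul]
    congr 1
    ring
  have hζq : ζ ^ q = 1 := by
    rw [hζ, ← Complex.exp_nat_mul, Complex.exp_eq_one_iff]
    exact ⟨n, by push_cast; field_simp⟩
  have hone : ζ = 1 ↔ q ∣ n := by
    rw [hζ, Complex.exp_eq_one_iff]
    constructor
    · rintro ⟨m, hm⟩
      have h2 : (n : ℂ) = q * m := by
        have hpi : (2 * (Real.pi : ℂ) * Complex.I) ≠ 0 := Complex.two_pi_I_ne_zero
        have h3 : (2 * (Real.pi : ℂ) * Complex.I) * ((n : ℂ) / q)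
            = (2 * (Real.pi : ℂ) * Complex.I) * m := by rw [hm]; ring
        have h4 := mul_left_cancel₀ hpi h3
        rw [← h4]; field_simp
      have h3 : (n : ℤ) = q * m := by exact_mod_cast h2
      exact Int.natCast_dvd_natCast.mp ⟨m, h3⟩
    · rintro ⟨m, rfl⟩
      exact ⟨m, by push_cast; field_simp⟩
  simp_rw [hpow]
  have hshift : ∑ k ∈ Finset.Icc 1 q, ζ ^ k = ζ * ∑ k ∈ Finset.range q, ζ ^ k := by
    rw [Finset.mul_sum, Finset.range_eq_Ico, ← Finset.sum_Ico_add_right_sub_eq 0 q 1]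
    refine Finset.sum_congr ?_ ?_
    · ext; simp
    · intro k hk
      have : 1 ≤ k := by simp at hk; omega
      rw [← pow_succ', Nat.sub_add_cancel this]
  rw [hshift]
  split_ifs with h
  · simp [hone.mpr h]
  · have hne : ζ - 1 ≠ 0 := sub_ne_zero.mpr (fun h' => h (hone.mp h'))
    have := mul_geom_sum ζ q
    rw [hζq, sub_self] at this
    rw [(mul_eq_zero.mp this).resolve_left hne, mul_zero]

/-- Sorting the fractions `k / q` by their reduced denominators. -/
lemma sum_ramanujanSum_divisors (q n : ℕ) (hq : 0 < q) :
    ∑ d ∈ q.divisors, ramanujanSum d n = if q ∣ n then (q : ℂ) else 0 := by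
  rw [← sum_exp_Icc_eq_ite q n hq]
  unfold ramanujanSum
  rw [Finset.sum_sigma']
  refine Finset.sum_bij' (fun x _ => x.2 * (q / x.1))
    (fun k _ => ⟨q / k.gcd q, k / k.gcd q⟩) ?_ ?_ ?_ ?_ ?_
  · rintro ⟨d, j⟩ hx
    simp only [Finset.mem_sigma, Nat.mem_divisors, Finset.mem_filter, Finset.mem_Icc] at hx ⊢
    obtain ⟨⟨⟨e, rfl⟩, -⟩, ⟨hj1, hj2⟩, -⟩ := hx
    have hd : 0 < d := by omega
    have he : 0 < e := Nat.pos_of_mul_pos_left hq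
    rw [Nat.mul_div_cancel_left _ hd]
    exact ⟨Nat.mul_pos hj1 he, Nat.mul_le_mul_right e hj2⟩
  · intro k hk
    simp only [Finset.mem_sigma, Nat.mem_divisors, Finset.mem_filter, Finset.mem_Icc] at hk ⊢
    have hg : 0 < k.gcd q := Nat.gcd_pos_of_pos_right _ hq
    refine ⟨⟨Nat.div_dvd_of_dvd (Nat.gcd_dvd_right _ _), hq.ne'⟩, ⟨?_, ?_⟩, ?_⟩
    · exact Nat.div_pos (Nat.le_of_dvd hk.1 (Nat.gcd_dvd_left _ _)) hg
    · exact Nat.div_le_div_right hk.2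
    · exact Nat.coprime_div_gcd_div_gcd hg
  · rintro ⟨d, j⟩ hx
    simp only [Finset.mem_sigma, Nat.mem_divisors, Finset.mem_filter, Finset.mem_Icc] at hx ⊢
    obtain ⟨⟨⟨e, rfl⟩, -⟩, ⟨hj1, hj2⟩, hc⟩ := hx
    have hd : 0 < d := by omega
    have he : 0 < e := Nat.pos_of_mul_pos_left hq
    have hg : (j * e).gcd (d * e) = e := by
      rw [Nat.gcd_mul_right, hc.gcd_eq_one, one_mul]
    rw [Nat.mul_div_cancel_left _ hd, hg, Nat.mul_div_cancel _ he, Nat.mul_div_cancel _ he]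
  · intro k hk
    have hgq : k.gcd q ∣ q := Nat.gcd_dvd_right _ _
    simp only
    rw [Nat.div_div_self hgq hq.ne', Nat.div_mul_cancel (Nat.gcd_dvd_left _ _)]
  · rintro ⟨d, j⟩ hx
    simp only [Finset.mem_sigma, Nat.mem_divisors, Finset.mem_filter, Finset.mem_Icc] at hx ⊢
    obtain ⟨⟨⟨e, rfl⟩, -⟩, ⟨hj1, hj2⟩, hc⟩ := hx
    have hd : 0 < d := by omega
    have he : 0 < e := Nat.pos_of_mul_pos_left hq
    have hd' : (d : ℂ) ≠ 0 := by exact_mod_cast hd.ne'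
    have he' : (e : ℂ) ≠ 0 := by exact_mod_cast he.ne'
    rw [Nat.mul_div_cancel_left _ hd]
    congr 3
    push_cast
    field_simp

/-- The arithmetic function equal to the identity on the divisors of `n` and to `0` elsewhere. -/
noncomputable def idOnDivisors (n : ℕ) : ArithmeticFunction ℝ :=
  ⟨fun d => if d ∣ n then (d : ℝ) else 0, by simp⟩

lemma idOnDivisors_apply (n d : ℕ) :
    idOnDivisors n d = if d ∣ n then (d : ℝ) else 0 := rfl

lemma idOnDivisors_isMultiplicative (n : ℕ) : (idOnDivisors n).IsMultiplicative := by
  refine ⟨by simp [idOnDivisors_apply], fun {a b} hab => ?_⟩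
  simp only [idOnDivisors_apply, mul_dvd_iff_of_coprime hab]
  split_ifs <;> simp_all

/-- **Kluyver's formula**: as a function of `q`, the Ramanujan sum `c_q(n)` is the Dirichlet
convolution of the Möbius function and the identity restricted to the divisors of `n`. -/
lemma ramanujanSum_eq_moebius_mul (q n : ℕ) (hq : 0 < q) :
    ramanujanSum q n =
      ((((ArithmeticFunction.moebius : ArithmeticFunction ℝ) * idOnDivisors n) q : ℝ) : ℂ) := by
  have h := (ArithmeticFunction.sum_eq_iff_sum_mul_moebius_eq
    (f := fun q => ramanujanSum q n) (g := fun q => if q ∣ n then (q : ℂ) else 0)).mp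
    (fun q hq => sum_ramanujanSum_divisors q n hq) q hq
  rw [← h, ArithmeticFunction.mul_apply]
  push_cast
  refine Finset.sum_congr rfl fun x _ => ?_
  rw [idOnDivisors_apply]
  split_ifs <;> simp

/-! ### Factoring the coefficients -/

/-- The coefficient `μ(q) c_q(n) / φ(q)` as a real arithmetic function of `q`. -/
noncomputable def ramanujanCoeff (n : ℕ) : ArithmeticFunction ℝ :=
  ⟨fun q => (ArithmeticFunction.moebius q : ℝ) / (q.totient : ℝ) *
    ((ArithmeticFunction.moebius : ArithmeticFunction ℝ) * idOnDivisors n) q, by simp⟩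

/-- `μ(m)² / φ(m)` for `m` coprime to `n`, and `0` otherwise. -/
noncomputable def coprimeInvTotient (n : ℕ) : ArithmeticFunction ℝ :=
  ⟨fun m => if m.Coprime n then (ArithmeticFunction.moebius m : ℝ) ^ 2 / (m.totient : ℝ) else 0,
    by simp⟩

/-- The Möbius function restricted to the divisors of `n`. -/
noncomputable def moebiusOnDivisors (n : ℕ) : ArithmeticFunction ℝ :=
  ⟨fun d => if d ∣ n then (ArithmeticFunction.moebius d : ℝ) else 0, by simp⟩

lemma ramanujanCoeff_apply (n q : ℕ) :
    ramanujanCoeff n q = (ArithmeticFunction.moebius q : ℝ) / (q.totient : ℝ) *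
    ((ArithmeticFunction.moebius : ArithmeticFunction ℝ) * idOnDivisors n) q := rfl

lemma coprimeInvTotient_apply (n m : ℕ) : coprimeInvTotient n m =
    if m.Coprime n then (ArithmeticFunction.moebius m : ℝ) ^ 2 / (m.totient : ℝ) else 0 := rfl

lemma moebiusOnDivisors_apply (n d : ℕ) : moebiusOnDivisors n d =
    if d ∣ n then (ArithmeticFunction.moebius d : ℝ) else 0 := rfl

lemma moebius_real_isMultiplicative :
    ((ArithmeticFunction.moebius : ArithmeticFunction ℝ)).IsMultiplicative :=
  ArithmeticFunction.isMultiplicative_moebius.intCast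

lemma ramanujanCoeff_isMultiplicative (n : ℕ) : (ramanujanCoeff n).IsMultiplicative := by
  have hc := moebius_real_isMultiplicative.mul (idOnDivisors_isMultiplicative n)
  refine ⟨by simp [ramanujanCoeff_apply, hc.map_one], fun {a b} hab => ?_⟩
  simp only [ramanujanCoeff_apply, hc.map_mul_of_coprime hab, Nat.totient_mul hab,
    ArithmeticFunction.isMultiplicative_moebius.map_mul_of_coprime hab]
  push_cast
  rw [mul_div_mul_comm]
  ring

lemma coprimeInvTotient_isMultiplicative (n : ℕ) : (coprimeInvTotient n).IsMultiplicative := by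
  refine ⟨by simp [coprimeInvTotient_apply], fun {a b} hab => ?_⟩
  simp only [coprimeInvTotient_apply, Nat.totient_mul hab, Nat.coprime_mul_iff_left,
    ArithmeticFunction.isMultiplicative_moebius.map_mul_of_coprime hab]
  push_cast
  rw [mul_pow, mul_div_mul_comm]
  split_ifs <;> simp_all

lemma moebiusOnDivisors_isMultiplicative (n : ℕ) : (moebiusOnDivisors n).IsMultiplicative := by
  refine ⟨by simp [moebiusOnDivisors_apply], fun {a b} hab => ?_⟩
  simp only [moebiusOnDivisors_apply, mul_dvd_iff_of_coprime hab,
    ArithmeticFunction.isMultiplicative_moebius.map_mul_of_coprime hab]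
  split_ifs <;> simp_all

lemma coprimeInvTotient_prime_pow_eq_zero (n : ℕ) {p : ℕ} (hp : p.Prime) (i : ℕ) (hi : 2 ≤ i) :
    coprimeInvTotient n (p ^ i) = 0 := by
  have h := moebius_prime_pow_eq_zero hp i hi
  rw [ArithmeticFunction.intCoe_apply] at h
  simp [coprimeInvTotient_apply, h]

lemma coprimeInvTotient_prime (n : ℕ) {p : ℕ} (hp : p.Prime) :
    coprimeInvTotient n p = if p ∣ n then 0 else ((p : ℝ) - 1)⁻¹ := by
  simp only [coprimeInvTotient_apply, hp.coprime_iff_not_dvd, Nat.totient_prime hp,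
    ArithmeticFunction.moebius_apply_prime hp, Nat.cast_sub hp.one_le]
  split_ifs <;> simp

/-- The part of `q` dividing `n` and the part coprime to `n` separate in `μ(q) c_q(n) / φ(q)`:
for squarefree `q` it equals `μ(d) / φ(q / d)` with `d = (q, n)`. -/
lemma ramanujanCoeff_eq_mul (n : ℕ) :
    ramanujanCoeff n = moebiusOnDivisors n * coprimeInvTotient n := by
  have hmul := (moebiusOnDivisors_isMultiplicative n).mul (coprimeInvTotient_isMultiplicative n)
  rw [(ramanujanCoeff_isMultiplicative n).eq_iff_eq_on_prime_powers _ _ hmul]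
  intro p i hp
  have hu : ∀ i, 2 ≤ i → moebiusOnDivisors n (p ^ i) = 0 := by
    intro i hi
    have h := moebius_prime_pow_eq_zero hp i hi
    rw [ArithmeticFunction.intCoe_apply] at h
    simp [moebiusOnDivisors_apply, h]
  have h1 : moebiusOnDivisors n 1 = 1 := (moebiusOnDivisors_isMultiplicative n).map_one
  have hup : moebiusOnDivisors n p = if p ∣ n then -1 else 0 := by
    simp [moebiusOnDivisors_apply, ArithmeticFunction.moebius_apply_prime hp]
  have hg1 : coprimeInvTotient n 1 = 1 := (coprimeInvTotient_isMultiplicative n).map_one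
  rcases i with _ | i
  · rw [pow_zero, (ramanujanCoeff_isMultiplicative n).map_one, hmul.map_one]
  · rw [mul_apply_prime_pow_succ hp hu, h1, hup]
    rcases i with _ | i
    · have hc := mul_apply_prime_pow_succ (f := idOnDivisors n) hp (moebius_prime_pow_eq_zero hp) 0
      rw [zero_add, pow_one] at hc
      rw [zero_add, pow_one, pow_zero, hg1, ramanujanCoeff_apply, hc,
        coprimeInvTotient_prime n hp, Nat.totient_prime hp, Nat.cast_sub hp.one_le]
      have hp1 : (p : ℝ) - 1 ≠ 0 := by
        have : (1 : ℝ) < p := by exact_mod_cast hp.one_lt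
        linarith
      simp only [ArithmeticFunction.intCoe_apply, ArithmeticFunction.moebius_apply_prime hp,
        idOnDivisors_apply, pow_zero, one_dvd, if_true, ArithmeticFunction.moebius_apply_one]
      push_cast
      split_ifs <;> field_simp <;> ring
    · have h := moebius_prime_pow_eq_zero hp (i + 1 + 1) (by omega)
      rw [ArithmeticFunction.intCoe_apply] at h
      rw [ramanujanCoeff_apply, h, coprimeInvTotient_prime_pow_eq_zero n hp _ (by omega)]
      rcases i with _ | i
      · rw [zero_add, pow_one, coprimeInvTotient_prime n hp]
        split_ifs <;> simp
      · rw [coprimeInvTotient_prime_pow_eq_zero n hp _ (by omega)]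
        simp

/-! ### Summability of multiplicative functions -/

/-- A nonnegative multiplicative function is summable as soon as the tails of its Euler factors
are summable over the primes. -/
lemma summable_of_multiplicative_of_tsum_le {f x : ℕ → ℝ} (hf : ∀ m, 0 ≤ f m) (hf0 : f 0 = 0)
    (hf1 : f 1 = 1) (hmul : ∀ {a b : ℕ}, a.Coprime b → f (a * b) = f a * f b)
    (hsum : ∀ {p : ℕ}, p.Prime → Summable fun k : ℕ => f (p ^ k))
    (hx : ∀ p, 0 ≤ x p) (hxs : Summable x)
    (hle : ∀ {p : ℕ}, p.Prime → ∑' k : ℕ, f (p ^ k) ≤ 1 + x p) : Summable f := by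
  refine summable_of_sum_le (c := Real.exp (∑' p, x p)) hf fun u => ?_
  obtain ⟨N, hN⟩ := u.exists_nat_subset_range
  obtain ⟨hs, hp⟩ := EulerProduct.summable_and_hasSum_smoothNumbers_prod_primesBelow_tsum
    (f := f) hf1 hmul (fun hp => (hsum hp).norm) N
  have hind : HasSum (Set.indicator N.smoothNumbers f)
      (∏ p ∈ N.primesBelow, ∑' k : ℕ, f (p ^ k)) := hasSum_subtype_iff_indicator.mp hp
  calc ∑ m ∈ u, f m = ∑ m ∈ u, Set.indicator N.smoothNumbers f m := by
        refine Finset.sum_congr rfl fun m hm => ?_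
        rcases Nat.eq_zero_or_pos m with rfl | hm0
        · simp [Set.indicator_apply, hf0]
        · have := Nat.mem_smoothNumbers_of_lt hm0 (Finset.mem_range.mp (hN hm))
          rw [Set.indicator_of_mem this]
    _ ≤ ∏ p ∈ N.primesBelow, ∑' k : ℕ, f (p ^ k) :=
        sum_le_hasSum _ (fun m _ => Set.indicator_nonneg (fun m _ => hf m) m) hind
    _ ≤ ∏ p ∈ N.primesBelow, (1 + x p) :=
        Finset.prod_le_prod (fun p _ => tsum_nonneg fun k => hf _)
          fun p hp => hle (Nat.prime_of_mem_primesBelow hp)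
    _ ≤ Real.exp (∑ p ∈ N.primesBelow, x p) := Real.prod_one_add_le_exp_sum _ hx
    _ ≤ Real.exp (∑' p, x p) :=
        Real.exp_le_exp.mpr (hxs.sum_le_tsum _ fun p _ => hx p)

/-! ### Logarithmic asymptotics of power series -/

lemma one_sub_pow_eq_geom_mul (z : ℝ) (d : ℕ) :
    1 - z ^ d = (∑ i ∈ Finset.range d, z ^ i) * (1 - z) := by
  have := geom_sum_mul z d
  linarith

lemma geom_sum_mem_Icc {z : ℝ} (h0 : 0 < z) (h1 : z < 1) {d : ℕ} (hd : 0 < d) :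
    ∑ i ∈ Finset.range d, z ^ i ∈ Set.Icc (1 : ℝ) d := by
  constructor
  · calc (1 : ℝ) = ∑ i ∈ Finset.range 1, z ^ i := by simp
      _ ≤ ∑ i ∈ Finset.range d, z ^ i :=
        Finset.sum_le_sum_of_subset_of_nonneg (Finset.range_mono hd)
          fun i _ _ => (pow_pos h0 i).le
  · calc ∑ i ∈ Finset.range d, z ^ i ≤ ∑ i ∈ Finset.range d, (1 : ℝ) :=
        Finset.sum_le_sum fun i _ => pow_le_one₀ h0.le h1.le
      _ = d := by simp

lemma log_one_sub_pow_sub {z : ℝ} (h0 : 0 < z) (h1 : z < 1) {d : ℕ} (hd : 0 < d) :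
    Real.log (1 - z ^ d) - Real.log (1 - z) = Real.log (∑ i ∈ Finset.range d, z ^ i) := by
  have hg := (geom_sum_mem_Icc h0 h1 hd).1
  rw [one_sub_pow_eq_geom_mul, Real.log_mul (by linarith) (by linarith)]
  ring

lemma tendsto_log_geom_sum {d : ℕ} (hd : 0 < d) :
    Filter.Tendsto (fun z : ℝ => Real.log (∑ i ∈ Finset.range d, z ^ i))
      (nhdsWithin 1 (Set.Iio 1)) (nhds (Real.log d)) := by
  have hc : ContinuousAt (fun z : ℝ => Real.log (∑ i ∈ Finset.range d, z ^ i)) 1 := by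
    refine ContinuousAt.log (by fun_prop) ?_
    simpa using hd.ne'
  simpa using hc.tendsto.mono_left nhdsWithin_le_nhds

lemma eventually_pos_lt_one :
    ∀ᶠ z : ℝ in nhdsWithin 1 (Set.Iio 1), 0 < z ∧ z < 1 :=
  Ioo_mem_nhdsLT (by norm_num : (0 : ℝ) < 1)

lemma hasSum_pnat_pow_div {x : ℝ} (h0 : 0 ≤ x) (h1 : x < 1) :
    HasSum (fun k : ℕ+ => x ^ (k : ℕ) / (k : ℕ)) (-Real.log (1 - x)) := by
  have h := Real.hasSum_pow_div_log_of_abs_lt_one (x := x) (by rwa [abs_of_nonneg h0])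
  rw [← Equiv.pnatEquivNat.symm.hasSum_iff]
  convert h using 2 with k
  simp

/-- Rearranging `∑ g(m) z ^ m`, where `m g(m) = ∑_{d ∣ m} b(d)`, into a series of logarithms. -/
lemma tsum_mul_pow_eq_tsum_log {g b : ℕ → ℝ}
    (hg : ∀ m : ℕ, 0 < m → (m : ℝ) * g m = ∑ d ∈ m.divisors, b d)
    (hb : Summable fun d : ℕ+ => |b d| / (d : ℕ)) {z : ℝ} (h0 : 0 < z) (h1 : z < 1) :
    ∑' m : ℕ+, g m * z ^ (m : ℕ) = ∑' d : ℕ+, b d / (d : ℕ) * -Real.log (1 - z ^ (d : ℕ)) := by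
  set F : ℕ+ × ℕ+ → ℝ := fun x => b x.1 / (x.1 : ℕ) * ((z ^ (x.1 : ℕ)) ^ (x.2 : ℕ) / (x.2 : ℕ))
    with hF
  have hgeom : Summable fun k : ℕ+ => z ^ (k : ℕ) :=
    (summable_geometric_of_lt_one h0.le h1).comp_injective PNat.coe_injective
  -- Absolute convergence of the double series: `(z ^ d) ^ k / k ≤ z ^ k`.
  have hFs : Summable F := by
    refine Summable.of_norm_bounded (g := fun x : ℕ+ × ℕ+ => |b x.1| / (x.1 : ℕ) * z ^ (x.2 : ℕ))
      (hb.mul_of_nonneg hgeom (fun d => by positivity) (fun k => by positivity)) ?_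
    rintro ⟨d, k⟩
    have hk : (1 : ℝ) ≤ ((k : ℕ) : ℝ) := by exact_mod_cast k.pos
    rw [hF, norm_mul, Real.norm_eq_abs, Real.norm_eq_abs, abs_div, Nat.abs_cast,
      abs_of_nonneg (by positivity : (0 : ℝ) ≤ (z ^ (d : ℕ)) ^ (k : ℕ) / (k : ℕ))]
    refine mul_le_mul_of_nonneg_left ?_ (by positivity)
    calc (z ^ (d : ℕ)) ^ (k : ℕ) / ((k : ℕ) : ℝ) ≤ (z ^ (d : ℕ)) ^ (k : ℕ) :=
          div_le_self (by positivity) hk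
      _ ≤ z ^ (k : ℕ) := pow_le_pow_left₀ (by positivity)
          (pow_le_of_le_one h0.le h1.le d.ne_zero) _
  have hright : ∑' x, F x = ∑' d : ℕ+, b d / (d : ℕ) * -Real.log (1 - z ^ (d : ℕ)) := by
    rw [hFs.tsum_prod]
    refine tsum_congr fun d => ?_
    simp only [hF]
    rw [tsum_mul_left,
      (hasSum_pnat_pow_div (by positivity) (pow_lt_one₀ h0.le h1 d.ne_zero)).tsum_eq]
  -- Grouping the pairs `(d, k)` by their product `m = d * k`.
  have hleft : ∑' x, F x = ∑' m : ℕ+, g m * z ^ (m : ℕ) := by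
    have hs' : Summable (F ∘ sigmaAntidiagonalEquivProd) :=
      sigmaAntidiagonalEquivProd.summable_iff.mpr hFs
    rw [← sigmaAntidiagonalEquivProd.tsum_eq F]
    refine (hs'.tsum_sigma' fun m => (hasSum_fintype _).summable).trans ?_
    refine tsum_congr fun m => ?_
    rw [tsum_fintype]
    have hm : ((m : ℕ) : ℝ) ≠ 0 := by exact_mod_cast m.ne_zero
    have hgm : g m = (∑ d ∈ (m : ℕ).divisors, b d) / (m : ℕ) := by
      rw [← hg m m.pos]; field_simp
    rw [hgm, ← Nat.sum_divisorsAntidiagonal (f := fun d _ => b d), Finset.sum_div,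
      Finset.sum_mul, ← Finset.sum_coe_sort (m : ℕ).divisorsAntidiagonal]
    refine Fintype.sum_congr _ _ ?_
    rintro ⟨⟨d, k⟩, hdk⟩
    have hprod := (Nat.mem_divisorsAntidiagonal.mp hdk).1
    simp only at hprod
    simp only [hF, Function.comp, sigmaAntidiagonalEquivProd, divisorsAntidiagonalFactors,
      Equiv.coe_fn_mk, PNat.mk_coe]
    rw [← pow_mul, hprod]
    rw [← hprod] at hm ⊢
    push_cast at hm ⊢
    have := left_ne_zero_of_mul hm
    have := right_ne_zero_of_mul hm
    field_simp
  rw [← hleft, hright]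

/-- If `m g(m) = ∑_{d ∣ m} b(d)` and `b(d) / d` sums to `κ` fast enough, then
`∑ g(m) z ^ m = - κ log (1 - z) + C + o(1)` as `z → 1⁻`. -/
lemma exists_tendsto_tsum_mul_pow_add_log {g b : ℕ → ℝ}
    (hg : ∀ m : ℕ, 0 < m → (m : ℝ) * g m = ∑ d ∈ m.divisors, b d)
    (hb : Summable fun d : ℕ+ => |b d| / (d : ℕ))
    (hbl : Summable fun d : ℕ+ => |b d| / (d : ℕ) * Real.log (d : ℕ)) :
    ∃ C : ℝ, Filter.Tendsto (fun z : ℝ => ∑' m : ℕ+, g m * z ^ (m : ℕ) +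
        (∑' d : ℕ+, b d / (d : ℕ)) * Real.log (1 - z))
      (nhdsWithin 1 (Set.Iio 1)) (nhds C) := by
  refine ⟨∑' d : ℕ+, b d / (d : ℕ) * -Real.log (d : ℕ), ?_⟩
  have key : ∀ z : ℝ, 0 < z → z < 1 → ∀ d : ℕ+,
      ‖b d / (d : ℕ) * -Real.log (∑ i ∈ Finset.range d, z ^ i)‖ ≤
        |b d| / (d : ℕ) * Real.log (d : ℕ) := by
    intro z h0 h1 d
    obtain ⟨hl, hu⟩ := geom_sum_mem_Icc h0 h1 d.pos
    rw [norm_mul, norm_neg, Real.norm_eq_abs, Real.norm_eq_abs, abs_div, Nat.abs_cast,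
      abs_of_nonneg (Real.log_nonneg hl)]
    exact mul_le_mul_of_nonneg_left (Real.log_le_log (by linarith) hu) (by positivity)
  have hlim : Filter.Tendsto
      (fun z : ℝ => ∑' d : ℕ+, b d / (d : ℕ) * -Real.log (∑ i ∈ Finset.range d, z ^ i))
      (nhdsWithin 1 (Set.Iio 1)) (nhds (∑' d : ℕ+, b d / (d : ℕ) * -Real.log (d : ℕ))) := by
    refine tendsto_tsum_of_dominated_convergence hbl (fun d => ?_) ?_
    · exact ((tendsto_log_geom_sum d.pos).neg).const_mul _
    · filter_upwards [eventually_pos_lt_one] with z hz using key z hz.1 hz.2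
  refine hlim.congr' ?_
  filter_upwards [eventually_pos_lt_one] with z hz
  obtain ⟨h0, h1⟩ := hz
  have hbs : Summable fun d : ℕ+ => b d / (d : ℕ) := by
    refine Summable.of_norm ?_
    simpa [abs_div] using hb
  have hs1 : Summable fun d : ℕ+ => b d / (d : ℕ) * -Real.log (∑ i ∈ Finset.range d, z ^ i) :=
    Summable.of_norm_bounded hbl (key z h0 h1)
  rw [tsum_mul_pow_eq_tsum_log hg hb h0 h1, ← tsum_mul_right, ← sub_eq_iff_eq_add,
    ← (hs1.tsum_sub (hbs.mul_right _))]
  refine tsum_congr fun d => ?_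
  rw [← log_one_sub_pow_sub h0 h1 d.pos]
  ring

/-! ### The mean value of the coefficients -/

/-- `m ↦ m μ(m)² / φ(m)` restricted to the `m` coprime to `n`. -/
noncomputable def idMulCoprimeInvTotient (n : ℕ) : ArithmeticFunction ℝ :=
  ⟨fun m => (m : ℝ) * coprimeInvTotient n m, by simp⟩

/-- The Dirichlet convolution of `μ` with `m ↦ m μ(m)² / φ(m)`, `(m, n) = 1`: the function `b`
with `∑_{d ∣ m} b(d) = m μ(m)² / φ(m)` for `m` coprime to `n`, and `0` for other `m`. -/
noncomputable def coprimeKernel (n : ℕ) : ArithmeticFunction ℝ :=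
  (ArithmeticFunction.moebius : ArithmeticFunction ℝ) * idMulCoprimeInvTotient n

lemma idMulCoprimeInvTotient_apply (n m : ℕ) :
    idMulCoprimeInvTotient n m = (m : ℝ) * coprimeInvTotient n m := rfl

lemma idMulCoprimeInvTotient_isMultiplicative (n : ℕ) :
    (idMulCoprimeInvTotient n).IsMultiplicative := by
  have hg := coprimeInvTotient_isMultiplicative n
  refine ⟨by simp [idMulCoprimeInvTotient_apply, hg.map_one], fun {a b} hab => ?_⟩
  simp only [idMulCoprimeInvTotient_apply, hg.map_mul_of_coprime hab]
  push_cast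
  ring

lemma coprimeKernel_isMultiplicative (n : ℕ) : (coprimeKernel n).IsMultiplicative :=
  moebius_real_isMultiplicative.mul (idMulCoprimeInvTotient_isMultiplicative n)

lemma sum_divisors_coprimeKernel (n m : ℕ) :
    (m : ℝ) * coprimeInvTotient n m = ∑ d ∈ m.divisors, coprimeKernel n d := by
  rw [← ArithmeticFunction.coe_zeta_mul_apply, coprimeKernel, ← mul_assoc,
    ArithmeticFunction.coe_zeta_mul_coe_moebius, one_mul, idMulCoprimeInvTotient_apply]

lemma coprimeKernel_prime_pow_succ (n : ℕ) {p : ℕ} (hp : p.Prime) (k : ℕ) :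
    coprimeKernel n (p ^ (k + 1)) =
      idMulCoprimeInvTotient n (p ^ (k + 1)) - idMulCoprimeInvTotient n (p ^ k) := by
  rw [coprimeKernel, mul_apply_prime_pow_succ hp (moebius_prime_pow_eq_zero hp),
    ArithmeticFunction.intCoe_apply, ArithmeticFunction.intCoe_apply,
    ArithmeticFunction.moebius_apply_prime hp, ArithmeticFunction.moebius_apply_one]
  push_cast
  ring

lemma coprimeKernel_prime (n : ℕ) {p : ℕ} (hp : p.Prime) :
    coprimeKernel n p = if p ∣ n then -1 else ((p : ℝ) - 1)⁻¹ := by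
  have h := coprimeKernel_prime_pow_succ n hp 0
  have hp1 : (p : ℝ) - 1 ≠ 0 := by
    have : (1 : ℝ) < p := by exact_mod_cast hp.one_lt
    linarith
  rw [zero_add, pow_one, pow_zero, (idMulCoprimeInvTotient_isMultiplicative n).map_one,
    idMulCoprimeInvTotient_apply, coprimeInvTotient_prime n hp] at h
  rw [h]
  split_ifs
  · simp
  · field_simp
    ring

lemma coprimeKernel_prime_sq (n : ℕ) {p : ℕ} (hp : p.Prime) :
    coprimeKernel n (p ^ 2) = if p ∣ n then 0 else -((p : ℝ) * ((p : ℝ) - 1)⁻¹) := by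
  have h := coprimeKernel_prime_pow_succ n hp 1
  rw [pow_one, idMulCoprimeInvTotient_apply, idMulCoprimeInvTotient_apply,
    coprimeInvTotient_prime_pow_eq_zero n hp _ le_rfl, coprimeInvTotient_prime n hp] at h
  rw [h]
  split_ifs <;> simp

lemma coprimeKernel_prime_pow_eq_zero (n : ℕ) {p : ℕ} (hp : p.Prime) (k : ℕ) (hk : 3 ≤ k) :
    coprimeKernel n (p ^ k) = 0 := by
  obtain ⟨j, rfl⟩ : ∃ j, k = j + 1 := ⟨k - 1, by omega⟩
  rw [coprimeKernel_prime_pow_succ n hp, idMulCoprimeInvTotient_apply,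
    idMulCoprimeInvTotient_apply, coprimeInvTotient_prime_pow_eq_zero n hp _ (by omega),
    coprimeInvTotient_prime_pow_eq_zero n hp _ (by omega)]
  simp

lemma hasSum_prime_pow_of_eq_zero {F : ℕ → ℝ} {p : ℕ} (hF : ∀ k, 3 ≤ k → F (p ^ k) = 0) :
    HasSum (fun k : ℕ => F (p ^ k)) (F 1 + F p + F (p ^ 2)) := by
  have h : HasSum (fun k : ℕ => F (p ^ k)) (∑ k ∈ Finset.range 3, F (p ^ k)) :=
    hasSum_sum_of_ne_finset_zero fun k hk => hF k (by simpa using hk)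
  simpa [Finset.sum_range_succ] using h

/-- The exponent `3 / 4` leaves room for an extra logarithm; any exponent in `(1 / 2, 1)` would
do, as the kernel has size about `1` on the squares of primes. -/
lemma summable_abs_coprimeKernel_mul_rpow (n : ℕ) (hn : n ≠ 0) :
    Summable fun d : ℕ => |coprimeKernel n d| * (d : ℝ) ^ (-(3 / 4) : ℝ) := by
  have hb := coprimeKernel_isMultiplicative n
  have hzero : ∀ {p : ℕ}, p.Prime → ∀ k, 3 ≤ k →
      |coprimeKernel n (p ^ k)| * ((p ^ k : ℕ) : ℝ) ^ (-(3 / 4) : ℝ) = 0 := by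
    intro p hp k hk
    rw [coprimeKernel_prime_pow_eq_zero n hp k hk, abs_zero, zero_mul]
  refine summable_of_multiplicative_of_tsum_le
    (x := fun p : ℕ => 4 * (p : ℝ) ^ (-(3 / 2) : ℝ) + if p ∣ n then 1 else 0)
    (fun m => by positivity) (by simp) (by simp [hb.map_one]) (fun {a b} hab => ?_)
    (fun {p} hp => (hasSum_prime_pow_of_eq_zero
      (F := fun d : ℕ => |coprimeKernel n d| * (d : ℝ) ^ (-(3 / 4) : ℝ)) (hzero hp)).summable)
    (fun p => by positivity) ?_ (fun {p} hp => ?_)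
  · rw [hb.map_mul_of_coprime hab, abs_mul, Nat.cast_mul,
      Real.mul_rpow (Nat.cast_nonneg a) (Nat.cast_nonneg b)]
    ring
  · refine ((Real.summable_nat_rpow.mpr (by norm_num)).mul_left 4).add ?_
    refine summable_of_ne_finset_zero (s := n.divisors) fun p hp => ?_
    rw [if_neg]
    exact fun h => hp (Nat.mem_divisors.mpr ⟨h, hn⟩)
  · rw [(hasSum_prime_pow_of_eq_zero
      (F := fun d : ℕ => |coprimeKernel n d| * (d : ℝ) ^ (-(3 / 4) : ℝ)) (hzero hp)).tsum_eq,
      hb.map_one, coprimeKernel_prime n hp, coprimeKernel_prime_sq n hp]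
    have hp2 : (2 : ℝ) ≤ p := by exact_mod_cast hp.two_le
    have hp0 : (0 : ℝ) < p := by linarith
    have hsq : ((p ^ 2 : ℕ) : ℝ) ^ (-(3 / 4) : ℝ) = (p : ℝ) ^ (-(3 / 2) : ℝ) := by
      rw [Nat.cast_pow, ← Real.rpow_natCast, ← Real.rpow_mul hp0.le]
      norm_num
    rw [hsq]
    split_ifs
    · have h1 : (p : ℝ) ^ (-(3 / 4) : ℝ) ≤ 1 :=
        Real.rpow_le_one_of_one_le_of_nonpos (by linarith) (by norm_num)
      have h2 : 0 ≤ (p : ℝ) ^ (-(3 / 2) : ℝ) := by positivity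
      norm_num
      linarith
    · have hinv : ((p : ℝ) - 1)⁻¹ ≤ 2 * (p : ℝ)⁻¹ := by
        rw [← div_eq_mul_inv, inv_eq_one_div, div_le_div_iff₀ (by linarith) hp0]
        linarith
      have hinv0 : 0 ≤ ((p : ℝ) - 1)⁻¹ := inv_nonneg.mpr (by linarith)
      have h1 : (p : ℝ)⁻¹ * (p : ℝ) ^ (-(3 / 4) : ℝ) ≤ (p : ℝ) ^ (-(3 / 2) : ℝ) := by
        rw [← Real.rpow_neg_one, ← Real.rpow_add hp0]
        exact Real.rpow_le_rpow_of_exponent_le (by linarith) (by norm_num)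
      have h2 : (p : ℝ) * ((p : ℝ) - 1)⁻¹ ≤ 2 := by
        calc (p : ℝ) * ((p : ℝ) - 1)⁻¹ ≤ p * (2 * (p : ℝ)⁻¹) :=
              mul_le_mul_of_nonneg_left hinv hp0.le
          _ = 2 := by field_simp
      have h3 : 0 ≤ (p : ℝ) ^ (-(3 / 4) : ℝ) := by positivity
      have h4 : 0 ≤ (p : ℝ) ^ (-(3 / 2) : ℝ) := by positivity
      rw [abs_of_nonneg hinv0, abs_neg, abs_of_nonneg (mul_nonneg hp0.le hinv0)]
      have h5 := mul_le_mul_of_nonneg_right hinv h3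
      have h6 := mul_le_mul_of_nonneg_right h2 h4
      norm_num
      linarith

lemma summable_abs_coprimeKernel_div (n : ℕ) (hn : n ≠ 0) :
    Summable fun d : ℕ => |coprimeKernel n d| / d := by
  refine (summable_abs_coprimeKernel_mul_rpow n hn).of_nonneg_of_le (fun d => by positivity) ?_
  intro d
  rcases Nat.eq_zero_or_pos d with rfl | hd
  · simp
  have hd1 : (1 : ℝ) ≤ d := by exact_mod_cast hd
  rw [div_eq_mul_inv, ← Real.rpow_neg_one]
  exact mul_le_mul_of_nonneg_left
    (Real.rpow_le_rpow_of_exponent_le hd1 (by norm_num)) (abs_nonneg _)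

lemma summable_abs_coprimeKernel_div_mul_log (n : ℕ) (hn : n ≠ 0) :
    Summable fun d : ℕ => |coprimeKernel n d| / d * Real.log d := by
  refine ((summable_abs_coprimeKernel_mul_rpow n hn).mul_left 4).of_nonneg_of_le
    (fun d => by positivity) ?_
  intro d
  rcases Nat.eq_zero_or_pos d with rfl | hd
  · simp
  have hd0 : (0 : ℝ) < d := by exact_mod_cast hd
  have hlog := Real.log_le_rpow_div hd0.le (by norm_num : (0 : ℝ) < 1 / 4)
  calc |coprimeKernel n d| / d * Real.log d
      ≤ |coprimeKernel n d| / d * ((d : ℝ) ^ (1 / 4 : ℝ) / (1 / 4)) :=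
        mul_le_mul_of_nonneg_left hlog (by positivity)
    _ = 4 * (|coprimeKernel n d| * ((d : ℝ) ^ (-1 : ℝ) * (d : ℝ) ^ (1 / 4 : ℝ))) := by
        rw [Real.rpow_neg_one]; ring
    _ = 4 * (|coprimeKernel n d| * (d : ℝ) ^ (-(3 / 4) : ℝ)) := by
        rw [← Real.rpow_add hd0]; norm_num

/-- In the Euler product of `∑ b(d) / d` the factors at primes not dividing `n` are `1`: the
contributions of `p` and `p ^ 2` cancel. -/
lemma tsum_coprimeKernel_div (n : ℕ) (hn : n ≠ 0) :
    ∑' d : ℕ, coprimeKernel n d / d = (n.totient : ℝ) / n := by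
  have hb := coprimeKernel_isMultiplicative n
  have hs : Summable fun d : ℕ => ‖coprimeKernel n d / d‖ := by
    simpa [abs_div] using summable_abs_coprimeKernel_div n hn
  have hprod := EulerProduct.eulerProduct_hasProd (f := fun d : ℕ => coprimeKernel n d / d)
    (by simp [hb.map_one])
    (fun {a b} hab => by
      simp only [hb.map_mul_of_coprime hab, Nat.cast_mul, mul_div_mul_comm]) hs (by simp)
  have hfac : ∀ p : Nat.Primes, ∑' k : ℕ, coprimeKernel n ((p : ℕ) ^ k) / (((p : ℕ) ^ k : ℕ) : ℝ) =
      if (p : ℕ) ∣ n then 1 - ((p : ℕ) : ℝ)⁻¹ else 1 := by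
    rintro ⟨p, hp⟩
    have h := (hasSum_prime_pow_of_eq_zero (F := fun d : ℕ => coprimeKernel n d / d) (p := p)
      fun k hk => by simp only [coprimeKernel_prime_pow_eq_zero n hp k hk, zero_div]).tsum_eq
    simp only at h ⊢
    rw [h, hb.map_one, coprimeKernel_prime n hp, coprimeKernel_prime_sq n hp]
    have hp1 : (p : ℝ) - 1 ≠ 0 := by
      have : (1 : ℝ) < p := by exact_mod_cast hp.one_lt
      linarith
    have hp0 : (p : ℝ) ≠ 0 := by exact_mod_cast hp.ne_zero
    push_cast
    split_ifs
    · ring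
    · field_simp
      ring
  simp only [hfac] at hprod
  rw [← hprod.tprod_eq]
  have htot : (n.totient : ℝ) / n = ∏ p ∈ n.primeFactors, (1 - (p : ℝ)⁻¹) := by
    have h := congrArg (fun x : ℚ => (x : ℝ)) (Nat.totient_eq_mul_prod_factors n)
    push_cast at h
    have hn0 : (n : ℝ) ≠ 0 := by exact_mod_cast hn
    rw [h]
    field_simp
  rw [htot]
  have hfin := tprod_subtype {p : ℕ | p.Prime}
    (fun p : ℕ => if p ∣ n then 1 - (p : ℝ)⁻¹ else 1)
  refine hfin.trans ?_
  rw [tprod_eq_prod (s := n.primeFactors)]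
  · refine Finset.prod_congr rfl fun p hp => ?_
    have hpp := Nat.prime_of_mem_primeFactors hp
    rw [Set.mulIndicator_of_mem (show p ∈ {p : ℕ | p.Prime} from hpp),
      if_pos (Nat.dvd_of_mem_primeFactors hp)]
  · intro p hp
    by_cases hpp : p.Prime
    · rw [Set.mulIndicator_of_mem (show p ∈ {p : ℕ | p.Prime} from hpp), if_neg]
      exact fun h => hp (Nat.mem_primeFactors.mpr ⟨hpp, h, hn⟩)
    · exact Set.mulIndicator_of_notMem hpp _

/-! ### The Ramanujan expansion -/

lemma hasSum_pnat_iff_of_apply_zero {f : ℕ → ℝ} {a : ℝ} (h0 : f 0 = 0) :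
    HasSum (fun m : ℕ+ => f m) a ↔ HasSum f a := by
  refine PNat.coe_injective.hasSum_iff fun m hm => ?_
  rcases Nat.eq_zero_or_pos m with rfl | hm0
  · exact h0
  · exact absurd ⟨⟨m, hm0⟩, rfl⟩ hm

lemma abs_coprimeInvTotient_le_one (n m : ℕ) : |coprimeInvTotient n m| ≤ 1 := by
  rw [coprimeInvTotient_apply]
  split_ifs
  · rcases Nat.eq_zero_or_pos m with rfl | hm
    · simp
    have hφ : (1 : ℝ) ≤ m.totient := by exact_mod_cast Nat.totient_pos.mpr hm
    have hμ : |(ArithmeticFunction.moebius m : ℝ)| ≤ 1 := by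
      exact_mod_cast ArithmeticFunction.abs_moebius_le_one
    rw [abs_div, Nat.abs_cast, abs_pow]
    exact div_le_one_of_le₀ ((pow_le_one₀ (abs_nonneg _) hμ).trans hφ) (by linarith)
  · simp

lemma summable_coprimeInvTotient_mul_pow (n : ℕ) {z : ℝ} (h0 : 0 ≤ z) (h1 : z < 1) :
    Summable fun m : ℕ => coprimeInvTotient n m * z ^ m := by
  refine Summable.of_norm_bounded (summable_geometric_of_lt_one h0 h1) fun m => ?_
  rw [norm_mul, Real.norm_eq_abs, norm_pow, Real.norm_of_nonneg h0]
  exact mul_le_of_le_one_left (pow_nonneg h0 m) (abs_coprimeInvTotient_le_one n m)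

lemma ramanujanCoeff_eq_sum (n q : ℕ) (hn : n ≠ 0) (hq : q ≠ 0) :
    ramanujanCoeff n q = ∑ d ∈ n.divisors, (ArithmeticFunction.moebius d : ℝ) *
      if d ∣ q then coprimeInvTotient n (q / d) else 0 := by
  rw [ramanujanCoeff_eq_mul, ArithmeticFunction.mul_apply,
    Nat.sum_divisorsAntidiagonal (f := fun a b => moebiusOnDivisors n a * coprimeInvTotient n b)]
  simp only [moebiusOnDivisors_apply, ite_mul, zero_mul, mul_ite, mul_zero]
  rw [← Finset.sum_filter, ← Finset.sum_filter]
  refine Finset.sum_congr ?_ fun _ _ => rfl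
  ext d
  simp only [Finset.mem_filter, Nat.mem_divisors]
  tauto

/-- The part of the expansion over the multiples `q` of `d` is the power series of
`μ(m)² / φ(m)`, `(m, n) = 1`, evaluated at `z ^ d`. -/
lemma hasSum_ite_dvd_coprimeInvTotient (n : ℕ) {d : ℕ} (hd : 0 < d) {z : ℝ} (h0 : 0 < z)
    (h1 : z < 1) :
    HasSum (fun q : ℕ => (if d ∣ q then coprimeInvTotient n (q / d) else 0) * z ^ q)
      (∑' m : ℕ+, coprimeInvTotient n m * (z ^ d) ^ (m : ℕ)) := by
  have hs := summable_coprimeInvTotient_mul_pow n (pow_pos h0 d).le (pow_lt_one₀ h0.le h1 hd.ne')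
  have hG := hs.hasSum
  rw [← ((hasSum_pnat_iff_of_apply_zero (by simp)).mpr hG).tsum_eq] at hG
  have hinj : Function.Injective fun m : ℕ => d * m := fun a b h => Nat.eq_of_mul_eq_mul_left hd h
  rw [← hinj.hasSum_iff]
  · convert hG using 2 with m
    simp [Nat.mul_div_cancel_left m hd, pow_mul]
  · intro q hq
    rw [if_neg, zero_mul]
    rintro ⟨m, rfl⟩
    exact hq ⟨m, rfl⟩

lemma hasSum_ramanujanCoeff_mul_pow (n : ℕ) (hn : n ≠ 0) {z : ℝ} (h0 : 0 < z) (h1 : z < 1) :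
    HasSum (fun q : ℕ+ => ramanujanCoeff n q * z ^ (q : ℕ))
      (∑ d ∈ n.divisors, (ArithmeticFunction.moebius d : ℝ) *
        ∑' m : ℕ+, coprimeInvTotient n m * (z ^ d) ^ (m : ℕ)) := by
  refine (hasSum_pnat_iff_of_apply_zero
    (f := fun q : ℕ => ramanujanCoeff n q * z ^ q) (by simp)).mpr ?_
  have h := hasSum_sum fun d (hd : d ∈ n.divisors) =>
    (hasSum_ite_dvd_coprimeInvTotient n (Nat.pos_of_mem_divisors hd) h0 h1).mul_left
      (ArithmeticFunction.moebius d : ℝ)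
  refine (congrArg (HasSum · _) (funext fun q => ?_)).mpr h
  rcases eq_or_ne q 0 with rfl | hq
  · simp
  · rw [ramanujanCoeff_eq_sum n q hn hq, Finset.sum_mul]
    exact Finset.sum_congr rfl fun d _ => mul_assoc _ _ _

lemma lambdaOneTerm_eq_ofReal (z : ℝ) (n : ℕ) (q : ℕ+) :
    lambdaOneTerm z n q = ((ramanujanCoeff n q * z ^ (q : ℕ) : ℝ) : ℂ) := by
  rw [lambdaOneTerm, ramanujanSum_eq_moebius_mul _ _ q.pos, ramanujanCoeff_apply]
  push_cast
  ring

lemma sum_divisors_moebius_eq_zero {n : ℕ} (hn : 2 ≤ n) :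
    ∑ d ∈ n.divisors, (ArithmeticFunction.moebius d : ℝ) = 0 := by
  have h : ((ArithmeticFunction.zeta : ArithmeticFunction ℝ) *
      (ArithmeticFunction.moebius : ArithmeticFunction ℝ)) n = 0 := by
    rw [ArithmeticFunction.coe_zeta_mul_coe_moebius,
      ArithmeticFunction.one_apply_ne (by omega)]
  rwa [ArithmeticFunction.coe_zeta_mul_apply] at h

lemma tendsto_pow_nhdsLT_one {d : ℕ} (hd : 0 < d) :
    Filter.Tendsto (fun z : ℝ => z ^ d) (nhdsWithin 1 (Set.Iio 1)) (nhdsWithin 1 (Set.Iio 1)) := by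
  refine tendsto_nhdsWithin_iff.mpr ⟨?_, ?_⟩
  · have hc : ContinuousAt (fun z : ℝ => z ^ d) 1 := by fun_prop
    simpa using hc.tendsto.mono_left nhdsWithin_le_nhds
  · filter_upwards [eventually_pos_lt_one] with z hz
    exact pow_lt_one₀ hz.1.le hz.2 hd.ne'

/-- The divergent terms `-κ log (1 - z)` and the constants `C` cancel because `∑_{d ∣ n} μ(d) = 0`;
what is left is `-κ ∑_{d ∣ n} μ(d) log d = κ Λ(n)`. -/
lemma tendsto_sum_moebius_mul_tsum {n : ℕ} (hn : 2 ≤ n) :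
    Filter.Tendsto (fun z : ℝ => ∑ d ∈ n.divisors, (ArithmeticFunction.moebius d : ℝ) *
        ∑' m : ℕ+, coprimeInvTotient n m * (z ^ d) ^ (m : ℕ))
      (nhdsWithin 1 (Set.Iio 1)) (nhds (modifiedVonMangoldt n)) := by
  have hn0 : n ≠ 0 := by omega
  have hκ : ∑' d : ℕ+, coprimeKernel n d / (d : ℕ) = (n.totient : ℝ) / n := by
    rw [← tsum_coprimeKernel_div n hn0]
    have hs : Summable fun d : ℕ => coprimeKernel n d / d :=
      Summable.of_norm (by simpa [abs_div] using summable_abs_coprimeKernel_div n hn0)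
    exact ((hasSum_pnat_iff_of_apply_zero (by simp)).mpr hs.hasSum).tsum_eq
  obtain ⟨C, hC⟩ := exists_tendsto_tsum_mul_pow_add_log
    (g := coprimeInvTotient n) (b := coprimeKernel n)
    (fun m _ => sum_divisors_coprimeKernel n m)
    ((summable_abs_coprimeKernel_div n hn0).comp_injective PNat.coe_injective)
    ((summable_abs_coprimeKernel_div_mul_log n hn0).comp_injective PNat.coe_injective)
  rw [hκ] at hC
  set κ : ℝ := (n.totient : ℝ) / n with hκdef
  have hsum : Filter.Tendsto (fun z : ℝ => ∑ d ∈ n.divisors, (ArithmeticFunction.moebius d : ℝ) *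
        ((∑' m : ℕ+, coprimeInvTotient n m * (z ^ d) ^ (m : ℕ) + κ * Real.log (1 - z ^ d)) -
          κ * Real.log (∑ i ∈ Finset.range d, z ^ i)))
      (nhdsWithin 1 (Set.Iio 1))
      (nhds (∑ d ∈ n.divisors, (ArithmeticFunction.moebius d : ℝ) * (C - κ * Real.log d))) := by
    refine tendsto_finsetSum _ fun d hd => ?_
    have hd0 := Nat.pos_of_mem_divisors hd
    exact ((hC.comp (tendsto_pow_nhdsLT_one hd0)).sub
      ((tendsto_log_geom_sum hd0).const_mul κ)).const_mul _
  have hval : ∑ d ∈ n.divisors, (ArithmeticFunction.moebius d : ℝ) * (C - κ * Real.log d) =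
      modifiedVonMangoldt n := by
    have hΛ := ArithmeticFunction.sum_moebius_mul_log_eq (n := n)
    simp only [ArithmeticFunction.log_apply] at hΛ
    have hsplit : ∀ d ∈ n.divisors, (ArithmeticFunction.moebius d : ℝ) * (C - κ * Real.log d) =
        (ArithmeticFunction.moebius d : ℝ) * C -
          κ * ((ArithmeticFunction.moebius d : ℝ) * Real.log d) := fun d _ => by ring
    rw [Finset.sum_congr rfl hsplit, Finset.sum_sub_distrib, ← Finset.sum_mul,
      sum_divisors_moebius_eq_zero hn, ← Finset.mul_sum, hΛ, modifiedVonMangoldt]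
    ring
  rw [hval] at hsum
  refine hsum.congr' ?_
  filter_upwards [eventually_pos_lt_one] with z hz
  obtain ⟨h0, h1⟩ := hz
  have hsplit : ∀ d ∈ n.divisors, (ArithmeticFunction.moebius d : ℝ) *
        ((∑' m : ℕ+, coprimeInvTotient n m * (z ^ d) ^ (m : ℕ) + κ * Real.log (1 - z ^ d)) -
          κ * Real.log (∑ i ∈ Finset.range d, z ^ i)) =
      (ArithmeticFunction.moebius d : ℝ) *
        ∑' m : ℕ+, coprimeInvTotient n m * (z ^ d) ^ (m : ℕ) +
      (ArithmeticFunction.moebius d : ℝ) * (κ * Real.log (1 - z)) := by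
    intro d hd
    rw [← log_one_sub_pow_sub h0 h1 (Nat.pos_of_mem_divisors hd)]
    ring
  rw [Finset.sum_congr rfl hsplit, Finset.sum_add_distrib, ← Finset.sum_mul,
    sum_divisors_moebius_eq_zero hn, zero_mul, add_zero]

theorem mainTheorem4 (n : ℕ) (hn : 2 ≤ n) :
    (∀ z : ℝ, 0 < z → z < 1 → Summable (fun q : ℕ+ => lambdaOneTerm z n (q : ℕ))) ∧
    Filter.Tendsto (fun z : ℝ => lambdaOnePowerSeries z n) (nhdsWithin 1 (Set.Iio 1))
      (nhds ((modifiedVonMangoldt n : ℝ) : ℂ)) := by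
  have hsum : ∀ z : ℝ, 0 < z → z < 1 →
      HasSum (fun q : ℕ+ => lambdaOneTerm z n q)
        ((∑ d ∈ n.divisors, (ArithmeticFunction.moebius d : ℝ) *
          ∑' m : ℕ+, coprimeInvTotient n m * (z ^ d) ^ (m : ℕ) : ℝ) : ℂ) := by
    intro z h0 h1
    simp only [lambdaOneTerm_eq_ofReal]
    exact Complex.hasSum_ofReal.mpr (hasSum_ramanujanCoeff_mul_pow n (by omega) h0 h1)
  refine ⟨fun z h0 h1 => (hsum z h0 h1).summable, ?_⟩
  refine ((Complex.continuous_ofReal.tendsto _).comp (tendsto_sum_moebius_mul_tsum hn)).congr' ?_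
  filter_upwards [eventually_pos_lt_one] with z hz
  exact (hsum z hz.1 hz.2).tsum_eq.symm
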